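/- Let $a,b,q\in\mathbb{C}$ with $|q|<1$ and $|a^2|<1$. Write $(x;q)_\infty=\prod_{k\ge 0}(1-xq^k)$ and $(x,y;q)_\infty=(x;q)_\infty(y;q)_\infty$. Then the numbers $(-a,b;q)_\infty-(a,-b;q)_\infty$ and $(-a,b;q)_\infty+(a,-b;q)_\infty$ are not both zero, so that their quotient is a well-defined point of the Riemann sphere $\hat{\mathbb{C}}=\mathbb{C}\cup\{\infty\}$, and the following hold. (i) If $q\neq 0$ and $|ab/q|<1$, then $$ \frac{(-a,b;q)_{\infty} - (a,-b;q)_{\infty}}{(-a,b;q)_{\infty}+ (a,-b;q)_{\infty}} = \cfrac{(a-b)q}{(ab+q)(1-q)-\cfrac{(a-bq^2)(b-aq^2)q}{(ab+q)(1-q^3)-\cfrac{(a-bq^4)(b-aq^4)q}{(ab+q)(1-q^5)-\cfrac{(a-bq^6)(b-aq^6)q}{(ab+q)(1-q^7)-\cdots}}}} $$ where the $k$-th partial numerator after the first is $-(a-bq^{2k})(b-aq^{2k})q$ and the partial denominators are $(ab+q)(1-q^{2k+1})$, $k\ge 0$. (ii) If $b\neq 0$ and $|aq/b|<1$, then $$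 \frac{(-a,b;q)_{\infty} - (a,-b;q)_{\infty}}{(-a,b;q)_{\infty}+ (a,-b;q)_{\infty}} = \cfrac{a-b}{1-ab-\cfrac{(1-a^2)(1-b^2)q}{1-abq^2-\cfrac{(a-bq^2)(b-aq^2)q}{1-abq^4-\cfrac{(1-a^2q^2)(1-b^2q^2)q^3}{1-abq^6-\cfrac{(a-bq^4)(b-aq^4)q^3}{1-abq^8-\cdots}}}}} $$ where the partial numerators after the first are, alternately, $-(1-a^2q^{2m})(1-b^2q^{2m})q^{2m+1}$ and $-(a-bq^{2m+2})(b-aq^{2m+2})q^{2m+1}$ for $m=0,1,2,\dots$, and the partial denominators are $1-abq^{2k}$, $k\ge 0$. In both parts, equality means that the approximants of the continued fraction, as points of $\hat{\mathbb{C}}$, converge in $\hat{\mathbb{C}}$ to the left side; a continued fraction with a vanishing partial numerator is understood to terminate just before the first such numerator. -/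

import Mathlib

noncomputable section

open Filter Topology OnePoint

/-- The infinite `q`-shifted factorial `(x; q)_∞ = ∏_{k ≥ 0} (1 - x q^k)`. -/
def qPochInf (x q : ℂ) : ℂ := ∏' k : ℕ, (1 - x * q ^ k)

/-- For `|q| < 1` the infinite product defining `(x; q)_∞` converges. -/
theorem qPochInf_multipliable (x q : ℂ) (hq : ‖q‖ < 1) :
    Multipliable (fun k : ℕ => 1 - x * q ^ k) := by
  have h : Summable (fun k : ℕ => ‖-(x * q ^ k)‖) := by
    simp only [norm_neg, norm_mul, norm_pow]
    exact (summable_geometric_of_lt_one (norm_nonneg q) hq).mul_left ‖x‖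
  simpa [sub_eq_add_neg] using multipliable_one_add_of_summable h

/-- The product `(x, y; q)_∞ = (x; q)_∞ (y; q)_∞`. -/
def qPochInf₂ (x y q : ℂ) : ℂ := qPochInf x q * qPochInf y q

/-- The quotient `u / v` as a point of the Riemann sphere `ℂ ∪ {∞}`, for `(u, v) ≠ (0, 0)`:
it is `∞` when `v = 0`. -/
def sphereDiv (u v : ℂ) : OnePoint ℂ :=
  open Classical in if v = 0 then ∞ else ((u / v : ℂ) : OnePoint ℂ)

/-- The map `w ↦ α / (β + w)` of the Riemann sphere into itself. For `α ≠ 0` this is the usual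
Möbius transformation (`∞ ↦ 0` and `-β ↦ ∞`). For `α = 0` it is constantly `0`, so that a
continued fraction stops in front of its first vanishing partial numerator. -/
def cfStep (α β : ℂ) : OnePoint ℂ → OnePoint ℂ
  | ∞ => ((0 : ℂ) : OnePoint ℂ)
  | (w : ℂ) => open Classical in
      if α = 0 then ((0 : ℂ) : OnePoint ℂ) else sphereDiv α (β + w)

/-- The composition `S_n = s_0 ∘ s_1 ∘ ⋯ ∘ s_{n-1}`, where `s_k w = α_k / (β_k + w)`. -/
def cfModifiedApproximant (α β : ℕ → ℂ) : ℕ → OnePoint ℂ → OnePoint ℂ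
  | 0 => id
  | n + 1 => fun w => cfModifiedApproximant α β n (cfStep (α n) (β n) w)

/-- The `n`-th approximant `α_0/(β_0 + α_1/(β_1 + ⋯ + α_{n-1}/β_{n-1}))`, a point of `ℂ ∪ {∞}`. -/
def cfApproximant (α β : ℕ → ℂ) (n : ℕ) : OnePoint ℂ :=
  cfModifiedApproximant α β n ((0 : ℂ) : OnePoint ℂ)

/-- The continued fraction `α_0/(β_0 + α_1/(β_1 + α_2/(β_2 + ⋯)))` converges to `f ∈ ℂ ∪ {∞}`:
its approximants tend to `f` in the topology of the Riemann sphere. -/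
def CFConvergesTo (α β : ℕ → ℂ) (f : OnePoint ℂ) : Prop :=
  Tendsto (cfApproximant α β) atTop (𝓝 f)

/-- The numerator `(-a, b; q)_∞ - (a, -b; q)_∞`. -/
def ramNum (a b q : ℂ) : ℂ := qPochInf₂ (-a) b q - qPochInf₂ a (-b) q

/-- The denominator `(-a, b; q)_∞ + (a, -b; q)_∞`. -/
def ramDen (a b q : ℂ) : ℂ := qPochInf₂ (-a) b q + qPochInf₂ a (-b) q

/-- Partial numerators of the first continued fraction, with their signs: `(a - b) q`, then
`-(a - b q^{2k})(b - a q^{2k}) q` for `k = 1, 2, …`. -/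
def firstNum (a b q : ℂ) : ℕ → ℂ
  | 0 => (a - b) * q
  | k + 1 => -((a - b * q ^ (2 * (k + 1))) * (b - a * q ^ (2 * (k + 1))) * q)

/-- Partial denominators of the first continued fraction: `(ab + q)(1 - q^{2k+1})`. -/
def firstDen (a b q : ℂ) (k : ℕ) : ℂ := (a * b + q) * (1 - q ^ (2 * k + 1))

/-- The entries `(1 - a² q^{2m})(1 - b² q^{2m}) q^{2m+1}`, `m = 0, 1, …`, of the second continued
fraction. -/
def secondNumOdd (a b q : ℂ) (m : ℕ) : ℂ :=
  (1 - a ^ 2 * q ^ (2 * m)) * (1 - b ^ 2 * q ^ (2 * m)) * q ^ (2 * m + 1)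

/-- The entries `(a - b q^{2m+2})(b - a q^{2m+2}) q^{2m+1}`, `m = 0, 1, …`, of the second
continued fraction. -/
def secondNumEven (a b q : ℂ) (m : ℕ) : ℂ :=
  (a - b * q ^ (2 * m + 2)) * (b - a * q ^ (2 * m + 2)) * q ^ (2 * m + 1)

/-- Partial numerators of the second continued fraction, with their signs. The entries at
`0, 1, 2, 3, 4` are `a - b`, `-(1-a²)(1-b²)q`, `-(a-bq²)(b-aq²)q`, `-(1-a²q²)(1-b²q²)q³`,
`-(a-bq⁴)(b-aq⁴)q³`. -/
def secondNum (a b q : ℂ) : ℕ → ℂ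
  | 0 => a - b
  | k + 1 => if k % 2 = 0 then -secondNumOdd a b q (k / 2) else -secondNumEven a b q (k / 2)

/-- Partial denominators of the second continued fraction: `1 - a b q^{2k}`. -/
def secondDen (a b q : ℂ) (k : ℕ) : ℂ := 1 - a * b * q ^ (2 * k)

end

open Filter Topology OnePoint

/-! ### Continued fractions on the Riemann sphere -/

/-! By the `q`-binomial theorem, `(b;q)_∞/(a;q)_∞` is the sum of the terms `qBinTerm a b q n`, and
changing `(a, b)` to `(-a, -b)` multiplies the `n`-th term by `(-1)^n`. So `ramDen` and `ramNum` are
`2 (a;q)_∞ (-a;q)_∞` times the even and the odd part of this series (`ramDen_eq_mul_heineSeries`).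
With `H(t,s)` for `heineSeries a b q t s`, these parts are `H(1,1)` and `(a-b)/(1-q) · H(q²,1)`.

Three-term contiguous relations link the values of `H`. Along `(t,1), (tq²,1), (tq⁴,1)` they give
the first continued fraction; along the staircase `(t,t), (tq²,t), (tq²,tq²), …` the second. After
normalisation they read `Y_n = β_n Y_{n+1} + α_{n+1} Y_{n+2}`, with `α_0 Y_1 : Y_0 = ramNum :
ramDen`.

Convergence to this ratio is a Pincherle argument (`cfConvergesTo_of_recurrence`), which needs
`α_{n+1} Y_{n+2} / Y_n` to have a limit `ρ` with `|ρ| < 1`. In the first case `ρ = -ab/q`, because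
`H(q^{2n},1)` tends to `H(0,1) ≠ 0`. In the second `ρ = 0`, because the partial numerators tend to
`0` and `H` tends to `H(0,0) = 1`. Homogeneous coordinates on the sphere make infinite values and
vanishing partial numerators harmless. -/

theorem sphereDiv_mul_left {c : ℂ} (hc : c ≠ 0) (u v : ℂ) :
    sphereDiv (c * u) (c * v) = sphereDiv u v := by
  by_cases hv : v = 0
  · simp [sphereDiv, hv]
  · simp [sphereDiv, hv, hc, mul_div_mul_left]

theorem sphereDiv_zero_left {v : ℂ} (hv : v ≠ 0) : sphereDiv 0 v = ((0 : ℂ) : OnePoint ℂ) := by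
  simp [sphereDiv, hv]

/-- In homogeneous coordinates `cfStep α β` is the linear map `(x, y) ↦ (α y, β y + x)`, wherever
the image does not vanish. -/
theorem cfStep_sphereDiv {α β x y : ℂ} (h : α * y ≠ 0 ∨ β * y + x ≠ 0) :
    cfStep α β (sphereDiv x y) = sphereDiv (α * y) (β * y + x) := by
  by_cases hy : y = 0
  · subst hy
    have hx : x ≠ 0 := by simpa using h
    simp [sphereDiv, cfStep, hx]
  · by_cases hα : α = 0
    · subst hα
      have hx : β * y + x ≠ 0 := by simpa using h
      simp [sphereDiv, cfStep, hy, hx]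
    · have e : sphereDiv (α * y) (β * y + x) = sphereDiv α (β + x / y) := by
        rw [← sphereDiv_mul_left hy α]
        congr 1
        · ring
        · field_simp
      rw [e]
      simp [sphereDiv, cfStep, hy, hα]

/-- Canonical numerators, with index shifted by one: `1, 0, α₀, …`. -/
def cfNumer (α β : ℕ → ℂ) : ℕ → ℂ
  | 0 => 1
  | 1 => 0
  | n + 2 => β n * cfNumer α β (n + 1) + α n * cfNumer α β n

/-- Canonical denominators, with index shifted by one: `0, 1, β₀, …`. -/
def cfDenom (α β : ℕ → ℂ) : ℕ → ℂ
  | 0 => 0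
  | 1 => 1
  | n + 2 => β n * cfDenom α β (n + 1) + α n * cfDenom α β n

theorem cfModifiedApproximant_sphereDiv (α β : ℕ → ℂ) (n : ℕ) (x y : ℂ)
    (h : cfNumer α β (n + 1) * y + cfNumer α β n * x ≠ 0 ∨
      cfDenom α β (n + 1) * y + cfDenom α β n * x ≠ 0) :
    cfModifiedApproximant α β n (sphereDiv x y) =
      sphereDiv (cfNumer α β (n + 1) * y + cfNumer α β n * x)
        (cfDenom α β (n + 1) * y + cfDenom α β n * x) := by
  induction n generalizing x y with
  | zero => simp [cfModifiedApproximant, cfNumer, cfDenom]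
  | succ n ih =>
    have e1 : cfNumer α β (n + 1 + 1) * y + cfNumer α β (n + 1) * x =
        cfNumer α β (n + 1) * (β n * y + x) + cfNumer α β n * (α n * y) := by
      rw [cfNumer]; ring
    have e2 : cfDenom α β (n + 1 + 1) * y + cfDenom α β (n + 1) * x =
        cfDenom α β (n + 1) * (β n * y + x) + cfDenom α β n * (α n * y) := by
      rw [cfDenom]; ring
    rw [e1, e2] at h ⊢
    rw [← ih _ _ h, ← cfStep_sphereDiv]
    · rfl
    · by_contra! hc
      simp [hc.1, hc.2] at h

theorem cfApproximant_eq_sphereDiv (α β : ℕ → ℂ) (n : ℕ)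
    (h : cfNumer α β (n + 1) ≠ 0 ∨ cfDenom α β (n + 1) ≠ 0) :
    cfApproximant α β n = sphereDiv (cfNumer α β (n + 1)) (cfDenom α β (n + 1)) := by
  have := cfModifiedApproximant_sphereDiv α β n 0 1 (by simpa using h)
  simpa [sphereDiv_zero_left, cfApproximant] using this

theorem tendsto_sphereDiv {ι : Type*} {l : Filter ι} {u v : ι → ℂ} {U V : ℂ}
    (hu : Tendsto u l (𝓝 U)) (hv : Tendsto v l (𝓝 V)) (h : U ≠ 0 ∨ V ≠ 0) :
    Tendsto (fun i => sphereDiv (u i) (v i)) l (𝓝 (sphereDiv U V)) := by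
  by_cases hV : V = 0
  · have hU : U ≠ 0 := by simpa [hV] using h
    subst hV
    have e : sphereDiv U 0 = ∞ := by simp [sphereDiv]
    rw [e, OnePoint.hasBasis_nhds_infty.tendsto_right_iff]
    rintro s ⟨-, hs⟩
    obtain ⟨R, hR⟩ := hs.isBounded.exists_norm_le
    -- The limit is `-‖U‖ < 0`, so eventually `‖u i‖ > (|R| + 1) ‖v i‖`, and the quotient leaves the
    -- ball of radius `R` containing the compact set.
    have hlim : Tendsto (fun i => (|R| + 1) * ‖v i‖ - ‖u i‖) l (𝓝 ((|R| + 1) * ‖(0 : ℂ)‖ - ‖U‖)) :=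
      (hv.norm.const_mul _).sub hu.norm
    have hneg : (|R| + 1) * ‖(0 : ℂ)‖ - ‖U‖ < 0 := by simpa using hU
    filter_upwards [hlim.eventually_lt_const hneg] with i hi
    by_cases hvi : v i = 0
    · simp [sphereDiv, hvi]
    · left
      refine ⟨u i / v i, ?_, by simp [sphereDiv, hvi]⟩
      intro hmem
      have h1 := hR _ hmem
      rw [norm_div, div_le_iff₀ (norm_pos_iff.2 hvi)] at h1
      nlinarith [le_abs_self R, norm_nonneg (v i)]
  · have e : sphereDiv U V = ((U / V : ℂ) : OnePoint ℂ) := by simp [sphereDiv, hV]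
    rw [e]
    refine ((OnePoint.continuous_coe.tendsto _).comp (hu.div hv hV)).congr' ?_
    filter_upwards [hv.eventually_ne hV] with i hi
    simp [sphereDiv, hi]

theorem tendsto_zero_of_le_mul_add {d e : ℕ → ℝ} {c : ℝ} (hc0 : 0 ≤ c) (hc : c < 1)
    (hd : ∀ n, 0 ≤ d n) (he : Tendsto e atTop (𝓝 0))
    (h : ∀ᶠ n in atTop, d (n + 1) ≤ c * d n + e n) : Tendsto d atTop (𝓝 0) := by
  rw [Metric.tendsto_atTop]
  intro ε hε
  -- Once `e n` is below this threshold, `c * (ε / 2) + e n < ε / 2`, so the excess of `d` over `ε /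
  -- 2` shrinks by the factor `c` at each step.
  have hε2 : 0 < ε / 2 * (1 - c) := mul_pos (half_pos hε) (by linarith)
  obtain ⟨N, hN⟩ := eventually_atTop.1 (h.and (he.eventually_lt_const hε2))
  have key : ∀ k, d (N + k) - ε / 2 ≤ c ^ k * |d N - ε / 2| := by
    intro k
    induction k with
    | zero => simpa using le_abs_self (d N - ε / 2)
    | succ k ih =>
      obtain ⟨h1, h2⟩ := hN (N + k) (by omega)
      calc d (N + (k + 1)) - ε / 2 ≤ c * (d (N + k) - ε / 2) := by
            rw [← add_assoc]; nlinarith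
        _ ≤ c * (c ^ k * |d N - ε / 2|) := mul_le_mul_of_nonneg_left ih hc0
        _ = _ := by ring
  have hp : Tendsto (fun k => c ^ k * |d N - ε / 2|) atTop (𝓝 (0 * |d N - ε / 2|)) :=
    (tendsto_pow_atTop_nhds_zero_of_lt_one hc0 hc).mul_const _
  rw [zero_mul] at hp
  obtain ⟨M, hM⟩ := eventually_atTop.1 (hp.eventually_lt_const (half_pos hε))
  refine ⟨N + M, fun n hn => ?_⟩
  obtain ⟨k, rfl⟩ := Nat.exists_eq_add_of_le (le_of_add_le_left hn)
  have h1 := key k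
  have h2 := hM k (by omega)
  rw [Real.dist_eq, sub_zero, abs_of_nonneg (hd _)]
  linarith

/-- `K / (1 + ρ)` is the fixed point of the limiting map `z ↦ K - ρ z`, a contraction; replacing `ρ`
by `r n` adds an error tending to `0`. -/
theorem tendsto_of_affine_recurrence {z r : ℕ → ℂ} {K ρ : ℂ} (hρ : ‖ρ‖ < 1)
    (hr : Tendsto r atTop (𝓝 ρ)) (hz : ∀ᶠ n in atTop, z (n + 1) = K - r n * z n) :
    Tendsto z atTop (𝓝 (K / (1 + ρ))) := by
  have hρ1 : 1 + ρ ≠ 0 := by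
    intro h
    have : ρ = -1 := by linear_combination h
    simp [this] at hρ
  obtain ⟨c, hc1, hc2⟩ := exists_between hρ
  rw [tendsto_iff_norm_sub_tendsto_zero]
  refine tendsto_zero_of_le_mul_add (c := c) (e := fun n => ‖(r n - ρ) * (K / (1 + ρ))‖)
    ((norm_nonneg _).trans hc1.le) hc2 (fun _ => norm_nonneg _) ?_ ?_
  · have := ((hr.sub_const ρ).mul_const (K / (1 + ρ))).norm
    simpa using this
  · filter_upwards [hz, hr.norm.eventually_lt_const hc1] with n h1 h2
    have e : z (n + 1) - K / (1 + ρ) =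
        -(r n * (z n - K / (1 + ρ))) + -((r n - ρ) * (K / (1 + ρ))) := by
      rw [h1]; field_simp; ring
    rw [e]
    refine (norm_add_le _ _).trans ?_
    rw [norm_neg, norm_neg, norm_mul (r n)]
    gcongr

/-- A form of Pincherle's theorem: a continued fraction whose backward recurrence has a solution
`Y` that is minimal, in the sense that `α_{n+1} Y_{n+2} / Y_n` tends to a limit inside the unit
disc, converges to `α_0 Y_1 / Y_0` in the Riemann sphere. -/
theorem cfConvergesTo_of_recurrence (α β Y : ℕ → ℂ) {ρ : ℂ} (hρ : ‖ρ‖ < 1)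
    (hY : ∀ n, Y n = β n * Y (n + 1) + α (n + 1) * Y (n + 2))
    (hne : ∀ᶠ n in atTop, Y n ≠ 0)
    (hr : Tendsto (fun n => α (n + 1) * Y (n + 2) / Y n) atTop (𝓝 ρ))
    (h0 : α 0 * Y 1 ≠ 0 ∨ Y 0 ≠ 0) :
    CFConvergesTo α β (sphereDiv (α 0 * Y 1) (Y 0)) := by
  -- A Casoratian-type invariant of the forward recurrence for the canonical numerators and the
  -- backward one for `Y`. With `z n = cfNumer α β (n + 1) * Y n` it becomes `z (n + 1) = K - r n *
  -- z n`, with no division by any `α n`; the denominators behave alike.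
  have invN : ∀ n, cfNumer α β (n + 1) * Y n + cfNumer α β n * (α n * Y (n + 1)) = α 0 * Y 1 := by
    intro n
    induction n with
    | zero => simp [cfNumer]
    | succ n ih => rw [← ih, hY n, cfNumer]; ring
  have invD : ∀ n, cfDenom α β (n + 1) * Y n + cfDenom α β n * (α n * Y (n + 1)) = Y 0 := by
    intro n
    induction n with
    | zero => simp [cfDenom]
    | succ n ih => rw [← ih, hY n, cfDenom]; ring
  have hρ1 : 1 + ρ ≠ 0 := by
    intro h
    have : ρ = -1 := by linear_combination h
    simp [this] at hρ
  have hN : Tendsto (fun n => cfNumer α β (n + 1) * Y n) atTop (𝓝 (α 0 * Y 1 / (1 + ρ))) := by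
    refine tendsto_of_affine_recurrence hρ hr ?_
    filter_upwards [hne] with n hn
    rw [← invN (n + 1)]
    field_simp
    ring
  have hD : Tendsto (fun n => cfDenom α β (n + 1) * Y n) atTop (𝓝 (Y 0 / (1 + ρ))) := by
    refine tendsto_of_affine_recurrence hρ hr ?_
    filter_upwards [hne] with n hn
    rw [← invD (n + 1)]
    field_simp
    ring
  have h0' : α 0 * Y 1 / (1 + ρ) ≠ 0 ∨ Y 0 / (1 + ρ) ≠ 0 :=
    h0.imp (fun h => div_ne_zero h hρ1) (fun h => div_ne_zero h hρ1)
  have hlim := tendsto_sphereDiv hN hD h0'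
  have e : sphereDiv (α 0 * Y 1 / (1 + ρ)) (Y 0 / (1 + ρ)) = sphereDiv (α 0 * Y 1) (Y 0) := by
    rw [div_eq_inv_mul, div_eq_inv_mul, sphereDiv_mul_left (inv_ne_zero hρ1)]
  rw [e] at hlim
  refine hlim.congr' ?_
  -- The two limits do not both vanish, so the canonical numerator and denominator are eventually
  -- not both zero, as the identification with the approximant requires.
  have hne2 : ∀ᶠ n in atTop, cfNumer α β (n + 1) ≠ 0 ∨ cfDenom α β (n + 1) ≠ 0 := by
    rcases h0' with h | h
    · filter_upwards [hN.eventually_ne h] with n hn using Or.inl (left_ne_zero_of_mul hn)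
    · filter_upwards [hD.eventually_ne h] with n hn using Or.inr (left_ne_zero_of_mul hn)
  filter_upwards [hne, hne2] with n hn hn2
  rw [cfApproximant_eq_sphereDiv α β n hn2, mul_comm _ (Y n), mul_comm _ (Y n),
    sphereDiv_mul_left hn]

/-! ### The `q`-binomial theorem -/

theorem one_sub_ne_zero_of_norm_lt_one {z : ℂ} (hz : ‖z‖ < 1) : 1 - z ≠ 0 := by
  intro h
  have : z = 1 := by linear_combination -h
  simp [this] at hz

theorem one_sub_mul_pow_ne_zero {x q : ℂ} (hq : ‖q‖ < 1) (hx : ‖x‖ ≤ 1) (k : ℕ) :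
    1 - x * q ^ (k + 1) ≠ 0 := by
  apply one_sub_ne_zero_of_norm_lt_one
  rw [norm_mul, norm_pow]
  exact (mul_le_of_le_one_left (by positivity) hx).trans_lt
    (pow_lt_one₀ (norm_nonneg _) hq (by omega))

theorem one_sub_pow_ne_zero {q : ℂ} (hq : ‖q‖ < 1) (k : ℕ) : 1 - q ^ (k + 1) ≠ 0 := by
  simpa using one_sub_mul_pow_ne_zero (x := 1) hq (by simp) k

theorem qPochInf_ne_zero {x q : ℂ} (hq : ‖q‖ < 1) (hx : ∀ k : ℕ, 1 - x * q ^ k ≠ 0) :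
    qPochInf x q ≠ 0 := by
  have := tprod_one_add_ne_zero_of_summable (f := fun k : ℕ => -(x * q ^ k))
    (by simpa [← sub_eq_add_neg] using hx)
    (by simpa using (summable_geometric_of_lt_one (norm_nonneg q) hq).mul_left ‖x‖)
  simpa [qPochInf, sub_eq_add_neg] using this

theorem qPochInf_ne_zero_of_norm_lt_one {x q : ℂ} (hq : ‖q‖ < 1) (hx : ‖x‖ < 1) :
    qPochInf x q ≠ 0 := by
  refine qPochInf_ne_zero hq fun k => one_sub_ne_zero_of_norm_lt_one ?_
  rw [norm_mul, norm_pow]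
  exact (mul_le_of_le_one_right (norm_nonneg _) (pow_le_one₀ (norm_nonneg _) hq.le)).trans_lt hx

/-- The real majorant of the terms of the `q`-series below. -/
noncomputable def qMajorant (u v r : ℝ) (n : ℕ) : ℝ := ∏ k ∈ Finset.range n, (u + v * r ^ k) / (1 - r ^ (k + 1))

theorem qMajorant_nonneg {u v r : ℝ} (hu : 0 ≤ u) (hv : 0 ≤ v) (hr : 0 ≤ r) (hr1 : r < 1) (n : ℕ) :
    0 ≤ qMajorant u v r n := by
  refine Finset.prod_nonneg fun k _ => div_nonneg (by positivity) ?_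
  have := pow_lt_one₀ hr hr1 (n := k + 1) (by omega)
  linarith

/-- The ratio of consecutive majorants tends to `u < 1`. The power `m = 1` serves the `q`-binomial
series; `m = 2` serves `heineSeries`, whose terms carry two such factors. -/
theorem summable_qMajorant_pow {u v r : ℝ} (hu : 0 ≤ u) (hu1 : u < 1) (hv : 0 ≤ v) (hr : 0 ≤ r)
    (hr1 : r < 1) {m : ℕ} (hm : m ≠ 0) : Summable fun n => qMajorant u v r n ^ m := by
  obtain ⟨c, hc1, hc2⟩ := exists_between hu1
  have hlim : Tendsto (fun k : ℕ => (u + v * r ^ k) / (1 - r ^ (k + 1))) atTop (𝓝 u) := by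
    have h1 := tendsto_pow_atTop_nhds_zero_of_lt_one hr hr1
    have h2 := (tendsto_add_atTop_iff_nat 1).2 h1
    have := ((h1.const_mul v).const_add u).div (h2.const_sub 1) (by norm_num)
    simp only [mul_zero, add_zero, sub_zero, div_one] at this
    exact this
  refine summable_of_ratio_norm_eventually_le (r := c ^ m)
    (pow_lt_one₀ (hu.trans hc1.le) hc2 hm) ?_
  filter_upwards [hlim.eventually_lt_const hc1] with n hn
  have h0 := qMajorant_nonneg hu hv hr hr1 n
  have h1 := qMajorant_nonneg hu hv hr hr1 (n + 1)
  rw [Real.norm_of_nonneg (by positivity), Real.norm_of_nonneg (by positivity), ← mul_pow]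
  refine pow_le_pow_left₀ h1 ?_ m
  rw [qMajorant, Finset.prod_range_succ, mul_comm]
  exact mul_le_mul_of_nonneg_right hn.le h0

/-- The terms `(y/x; q)_n x^n / (q; q)_n` of the `q`-binomial series. -/
noncomputable def qBinTerm (x y q : ℂ) (n : ℕ) : ℂ :=
  ∏ k ∈ Finset.range n, (x - y * q ^ k) / (1 - q ^ (k + 1))

theorem qBinTerm_succ (x y q : ℂ) (n : ℕ) :
    qBinTerm x y q (n + 1) = qBinTerm x y q n * ((x - y * q ^ n) / (1 - q ^ (n + 1))) :=
  Finset.prod_range_succ _ _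

theorem norm_one_sub_ge {z : ℂ} {r : ℝ} (h : ‖z‖ ≤ r) : 1 - r ≤ ‖1 - z‖ := by
  have := norm_sub_norm_le (1 : ℂ) z
  rw [norm_one] at this
  linarith

theorem norm_qBinTerm_le {q : ℂ} (x y : ℂ) (hq : ‖q‖ < 1) (n : ℕ) :
    ‖qBinTerm x y q n‖ ≤ qMajorant ‖x‖ ‖y‖ ‖q‖ n := by
  rw [qBinTerm, norm_prod]
  refine Finset.prod_le_prod (fun _ _ => norm_nonneg _) fun k _ => ?_
  have h1 := pow_lt_one₀ (norm_nonneg q) hq (n := k + 1) (by omega)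
  rw [norm_div]
  refine div_le_div₀ (by positivity) ?_ (by linarith) (norm_one_sub_ge (by simp))
  refine (norm_sub_le _ _).trans ?_
  simp

theorem summable_qBinTerm {x q : ℂ} (y : ℂ) (hq : ‖q‖ < 1) (hx : ‖x‖ < 1) :
    Summable (qBinTerm x y q) := by
  refine Summable.of_norm_bounded (g := qMajorant ‖x‖ ‖y‖ ‖q‖) ?_ (norm_qBinTerm_le x y hq)
  simpa using summable_qMajorant_pow (norm_nonneg x) hx (norm_nonneg y) (norm_nonneg q) hq
    one_ne_zero

theorem qBinTerm_mul (c x y q : ℂ) (n : ℕ) :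
    qBinTerm (c * x) (c * y) q n = c ^ n * qBinTerm x y q n := by
  induction n with
  | zero => simp [qBinTerm]
  | succ n ih => rw [qBinTerm_succ, qBinTerm_succ, ih]; ring

/-- The common device behind the functional equation of the `q`-binomial series and the contiguous
relations: the partial sums of the required linear combination have a closed form `S N`, which tends
to `0` because it is a bounded multiple of a term of a convergent series. -/
theorem tsum_eq_zero_of_sum_tendsto_zero {f S : ℕ → ℂ} (hf : Summable f)
    (hS : ∀ N, ∑ n ∈ Finset.range (N + 1), f n = S N) (h0 : Tendsto S atTop (𝓝 0)) :
    ∑' n, f n = 0 := by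
  refine tendsto_nhds_unique ((tendsto_add_atTop_iff_nat 1).2 hf.hasSum.tendsto_sum_nat) ?_
  simpa only [hS] using h0

theorem tsum_qBinTerm_functional {x q : ℂ} (y : ℂ) (hq : ‖q‖ < 1) (hx : ‖x‖ < 1) :
    (1 - x) * ∑' n, qBinTerm x y q n = (1 - y) * ∑' n, qBinTerm (q * x) (q * y) q n := by
  have s1 := summable_qBinTerm y hq hx
  have s2 : Summable (qBinTerm (q * x) (q * y) q) := by
    refine summable_qBinTerm _ hq ?_
    rw [norm_mul]
    exact (mul_le_of_le_one_left (norm_nonneg _) hq.le).trans_lt hx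
  have hsum : ∀ N, ∑ n ∈ Finset.range (N + 1),
      ((1 - x) * qBinTerm x y q n - (1 - y) * qBinTerm (q * x) (q * y) q n) =
        -((x - y * q ^ N) * qBinTerm x y q N) := by
    intro N
    induction N with
    | zero => simp [qBinTerm]
    | succ N ih =>
      have := one_sub_pow_ne_zero hq N
      rw [Finset.sum_range_succ, ih, qBinTerm_mul, qBinTerm_succ]
      field_simp
      ring
  have h := tsum_eq_zero_of_sum_tendsto_zero ((s1.mul_left (1 - x)).sub (s2.mul_left (1 - y))) hsum
    (by
      have h1 := tendsto_pow_atTop_nhds_zero_of_norm_lt_one hq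
      have := (((h1.const_mul y).const_sub x).mul s1.tendsto_atTop_zero).neg
      simpa using this)
  rw [(s1.mul_left (1 - x)).tsum_sub (s2.mul_left (1 - y)), tsum_mul_left, tsum_mul_left] at h
  linear_combination h

/-- The `q`-binomial theorem `∑ (y/x; q)_n x^n / (q; q)_n = (y; q)_∞ / (x; q)_∞`. -/
theorem tsum_qBinTerm_mul_qPochInf {x q : ℂ} (y : ℂ) (hq : ‖q‖ < 1) (hx : ‖x‖ < 1) :
    (∑' n, qBinTerm x y q n) * qPochInf x q = qPochInf y q := by
  -- The functional equation iterated `N` times. As `N → ∞` the scaled series tends to its constant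
  -- term `1`, by dominated convergence.
  have hstep : ∀ N : ℕ, (∏ k ∈ Finset.range N, (1 - x * q ^ k)) * ∑' n, qBinTerm x y q n =
      (∏ k ∈ Finset.range N, (1 - y * q ^ k)) *
        ∑' n, qBinTerm (q ^ N * x) (q ^ N * y) q n := by
    intro N
    induction N with
    | zero => simp
    | succ N ih =>
      have hx' : ‖q ^ N * x‖ < 1 := by
        rw [norm_mul, norm_pow]
        exact (mul_le_of_le_one_left (norm_nonneg _)
          (pow_le_one₀ (norm_nonneg _) hq.le)).trans_lt hx
      have hf := tsum_qBinTerm_functional (q ^ N * y) hq hx'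
      rw [← mul_assoc, ← mul_assoc, ← pow_succ'] at hf
      rw [Finset.prod_range_succ, Finset.prod_range_succ]
      linear_combination (1 - x * q ^ N) * ih + (∏ k ∈ Finset.range N, (1 - y * q ^ k)) * hf
  have hlim : Tendsto (fun N : ℕ => ∑' n, qBinTerm (q ^ N * x) (q ^ N * y) q n) atTop (𝓝 1) := by
    have h1 : ∑' n : ℕ, (if n = 0 then (1 : ℂ) else 0) = 1 := by simp
    rw [← h1]
    refine tendsto_tsum_of_dominated_convergence
      (summable_qBinTerm y hq hx).norm (fun n => ?_) (Eventually.of_forall fun N n => ?_)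
    · simp_rw [qBinTerm_mul]
      rcases Nat.eq_zero_or_pos n with rfl | hn
      · simp [qBinTerm]
      · have h2 := ((tendsto_pow_atTop_nhds_zero_of_norm_lt_one hq).pow n).mul_const
          (qBinTerm x y q n)
        simpa [hn.ne'] using h2
    · rw [qBinTerm_mul, norm_mul, norm_pow, norm_pow]
      exact mul_le_of_le_one_left (norm_nonneg _)
        (pow_le_one₀ (by positivity) (pow_le_one₀ (norm_nonneg _) hq.le))
  have hX := (qPochInf_multipliable x q hq).hasProd.tendsto_prod_nat
  have hYp := (qPochInf_multipliable y q hq).hasProd.tendsto_prod_nat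
  have := tendsto_nhds_unique ((hX.mul_const _).congr hstep) (hYp.mul hlim)
  rw [qPochInf, qPochInf, mul_comm, this, mul_one]

theorem tsum_qBinTerm_ne_zero {x y q : ℂ} (hq : ‖q‖ < 1) (hx : ‖x‖ < 1) (hy : ‖y‖ < 1) :
    ∑' n, qBinTerm x y q n ≠ 0 := by
  intro h
  have := tsum_qBinTerm_mul_qPochInf y hq hx
  rw [h, zero_mul] at this
  exact qPochInf_ne_zero_of_norm_lt_one hq hy this.symm

/-- If both vanished, so would `(b;q)_∞` and `(-b;q)_∞`, since `|a| < 1` keeps the other factors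
nonzero. Then `b q^j = 1 = -b q^k`, so `q^j = -q^k`; comparing moduli gives `j = k`, which is
absurd. -/
theorem ramNum_ne_zero_or_ramDen_ne_zero {a q : ℂ} (b : ℂ) (hq : ‖q‖ < 1) (ha : ‖a‖ < 1) :
    ramNum a b q ≠ 0 ∨ ramDen a b q ≠ 0 := by
  by_contra! h
  obtain ⟨h1, h2⟩ := h
  have e1 : qPochInf (-a) q * qPochInf b q = 0 := by
    simp only [ramNum, ramDen, qPochInf₂] at h1 h2
    linear_combination (h1 + h2) / 2
  have e2 : qPochInf a q * qPochInf (-b) q = 0 := by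
    simp only [ramNum, ramDen, qPochInf₂] at h1 h2
    linear_combination (h2 - h1) / 2
  have f1 := (mul_eq_zero.1 e1).resolve_left
    (qPochInf_ne_zero_of_norm_lt_one hq (by simpa using ha))
  have f2 := (mul_eq_zero.1 e2).resolve_left (qPochInf_ne_zero_of_norm_lt_one hq ha)
  obtain ⟨j, hj⟩ : ∃ j : ℕ, 1 - b * q ^ j = 0 := by
    by_contra! h
    exact qPochInf_ne_zero hq h f1
  obtain ⟨k, hk⟩ : ∃ k : ℕ, 1 - -b * q ^ k = 0 := by
    by_contra! h
    exact qPochInf_ne_zero hq h f2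
  have hb : b ≠ 0 := by
    rintro rfl
    simp at hj
  have hjk : q ^ j = -q ^ k := by
    apply mul_left_cancel₀ hb
    linear_combination -hj + hk
  have hj0 : q ^ j ≠ 0 := by
    intro h
    simp [h] at hj
  have e : j = k := by
    -- For `q = 0` powers are not injective in the exponent, but a nonzero power of `0` forces
    -- exponent `0`.
    by_cases hq0 : q = 0
    · have hk0 : q ^ k ≠ 0 := by simpa [hjk] using hj0
      subst hq0
      rw [not_imp_comm.1 (zero_pow (M₀ := ℂ)) hj0, not_imp_comm.1 (zero_pow (M₀ := ℂ)) hk0]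
    · exact pow_right_injective₀ (norm_pos_iff.2 hq0) hq.ne
        (by simpa using congrArg norm hjk)
  subst e
  exact hj0 (self_eq_neg.1 hjk)

/-! ### A two-parameter basic hypergeometric series and its contiguous relations -/

/-- `∏_{k<n} (a - b q^{2k+1}) / (1 - q^{2k+2})`. -/
noncomputable def oddFactor (a b q : ℂ) (n : ℕ) : ℂ :=
  ∏ k ∈ Finset.range n, (a - b * q ^ (2 * k + 1)) / (1 - q ^ (2 * k + 1 + 1))

/-- `∏_{k<n} (a - b t q^{2k}) / (1 - t q^{2k+1})`. -/
noncomputable def evenFactor (a b q t : ℂ) (n : ℕ) : ℂ :=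
  ∏ k ∈ Finset.range n, (a - b * t * q ^ (2 * k)) / (1 - t * q ^ (2 * k + 1))

/-- The series `₂φ₁(qb/a, bt/a; qt; q², a²s)`. -/
noncomputable def heineSeries (a b q t s : ℂ) : ℂ :=
  ∑' n, oddFactor a b q n * evenFactor a b q t n * s ^ n

theorem oddFactor_succ (a b q : ℂ) (n : ℕ) : oddFactor a b q (n + 1) =
    oddFactor a b q n * ((a - b * q ^ (2 * n + 1)) / (1 - q ^ (2 * n + 1 + 1))) :=
  Finset.prod_range_succ _ _

theorem evenFactor_succ (a b q t : ℂ) (n : ℕ) : evenFactor a b q t (n + 1) =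
    evenFactor a b q t n * ((a - b * t * q ^ (2 * n)) / (1 - t * q ^ (2 * n + 1))) :=
  Finset.prod_range_succ _ _

/-- Splitting off the factor at `k = 0` shifts `t` to `t q²`; this is what relates series with
neighbouring values of `t`. -/
theorem evenFactor_succ' (a b q t : ℂ) (n : ℕ) : evenFactor a b q t (n + 1) =
    (a - b * t) / (1 - t * q) * evenFactor a b q (t * q ^ 2) n := by
  rw [evenFactor, Finset.prod_range_succ', evenFactor, mul_comm]
  congr 1
  · simp
  · refine Finset.prod_congr rfl fun k _ => ?_
    congr 1 <;> ring

section

variable {a b q : ℂ}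

theorem norm_oddFactor_le (a b : ℂ) (hq : ‖q‖ < 1) (n : ℕ) :
    ‖oddFactor a b q n‖ ≤ qMajorant ‖a‖ ‖b‖ ‖q‖ n := by
  rw [oddFactor, norm_prod]
  refine Finset.prod_le_prod (fun _ _ => norm_nonneg _) fun k _ => ?_
  have h1 := pow_lt_one₀ (norm_nonneg q) hq (n := k + 1) (by omega)
  have h2 : ∀ j, k ≤ j → ‖q ^ j‖ ≤ ‖q‖ ^ k := fun j hj => by
    rw [norm_pow]; exact pow_le_pow_of_le_one (norm_nonneg _) hq.le hj
  rw [norm_div]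
  refine div_le_div₀ (by positivity) ?_ (by linarith) (norm_one_sub_ge ?_)
  · refine (norm_sub_le _ _).trans ?_
    rw [norm_mul]
    gcongr
    exact h2 _ (by omega)
  · rw [norm_pow]
    exact pow_le_pow_of_le_one (norm_nonneg _) hq.le (by omega)

theorem norm_evenFactor_le (a b : ℂ) {t : ℂ} (hq : ‖q‖ < 1) (ht : ‖t‖ ≤ 1) (n : ℕ) :
    ‖evenFactor a b q t n‖ ≤ qMajorant ‖a‖ ‖b‖ ‖q‖ n := by
  rw [evenFactor, norm_prod]
  refine Finset.prod_le_prod (fun _ _ => norm_nonneg _) fun k _ => ?_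
  have h1 := pow_lt_one₀ (norm_nonneg q) hq (n := k + 1) (by omega)
  have h2 : ∀ i j, i ≤ j → ‖t * q ^ j‖ ≤ ‖q‖ ^ i := fun i j hj => by
    rw [norm_mul, norm_pow]
    exact (mul_le_of_le_one_left (by positivity) ht).trans
      (pow_le_pow_of_le_one (norm_nonneg _) hq.le hj)
  rw [norm_div]
  refine div_le_div₀ (by positivity) ?_ (by linarith) (norm_one_sub_ge (h2 _ _ (by omega)))
  refine (norm_sub_le _ _).trans ?_
  rw [mul_assoc, norm_mul]
  gcongr
  exact h2 _ _ (by omega)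

theorem norm_heineSeries_term_le (a b : ℂ) {t s : ℂ} (hq : ‖q‖ < 1) (ht : ‖t‖ ≤ 1) (hs : ‖s‖ ≤ 1)
    (n : ℕ) :
    ‖oddFactor a b q n * evenFactor a b q t n * s ^ n‖ ≤ qMajorant ‖a‖ ‖b‖ ‖q‖ n ^ 2 := by
  have h0 := qMajorant_nonneg (norm_nonneg a) (norm_nonneg b) (norm_nonneg q) hq n
  rw [norm_mul, norm_mul, norm_pow, sq]
  refine (mul_le_of_le_one_right (by positivity) (pow_le_one₀ (norm_nonneg _) hs)).trans ?_
  exact mul_le_mul (norm_oddFactor_le a b hq n) (norm_evenFactor_le a b hq ht n) (norm_nonneg _) h0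

theorem summable_heineSeries (b : ℂ) {t s : ℂ} (hq : ‖q‖ < 1) (ha : ‖a‖ < 1) (ht : ‖t‖ ≤ 1)
    (hs : ‖s‖ ≤ 1) : Summable fun n => oddFactor a b q n * evenFactor a b q t n * s ^ n :=
  Summable.of_norm_bounded (summable_qMajorant_pow (norm_nonneg a) ha (norm_nonneg b)
    (norm_nonneg q) hq two_ne_zero) (norm_heineSeries_term_le a b hq ht hs)

theorem tendsto_evenFactor (a b : ℂ) {ι : Type*} {l : Filter ι} {t : ι → ℂ} {t₀ : ℂ} (hq : ‖q‖ < 1)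
    (ht₀ : ‖t₀‖ ≤ 1) (ht : Tendsto t l (𝓝 t₀)) (n : ℕ) :
    Tendsto (fun i => evenFactor a b q (t i) n) l (𝓝 (evenFactor a b q t₀ n)) :=
  tendsto_finsetProd _ fun _ _ => ((((ht.const_mul b).mul_const _).const_sub a).div
    ((ht.mul_const _).const_sub 1) (one_sub_mul_pow_ne_zero hq ht₀ _))

theorem tendsto_heineSeries (b : ℂ) {ι : Type*} {l : Filter ι} {t s : ι → ℂ} {t₀ s₀ : ℂ}
    (hq : ‖q‖ < 1) (ha : ‖a‖ < 1) (ht₀ : ‖t₀‖ ≤ 1) (ht1 : ∀ i, ‖t i‖ ≤ 1) (hs1 : ∀ i, ‖s i‖ ≤ 1)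
    (ht : Tendsto t l (𝓝 t₀)) (hs : Tendsto s l (𝓝 s₀)) :
    Tendsto (fun i => heineSeries a b q (t i) (s i)) l (𝓝 (heineSeries a b q t₀ s₀)) :=
  tendsto_tsum_of_dominated_convergence
    (summable_qMajorant_pow (norm_nonneg a) ha (norm_nonneg b) (norm_nonneg q) hq two_ne_zero)
    (fun n => ((tendsto_evenFactor a b hq ht₀ ht n).const_mul _).mul (hs.pow n))
    (Eventually.of_forall fun i n => norm_heineSeries_term_le a b hq (ht1 i) (hs1 i) n)

theorem heineSeries_zero_right (a b q t : ℂ) : heineSeries a b q t 0 = 1 := by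
  rw [heineSeries, tsum_eq_single 0]
  · simp [oddFactor, evenFactor]
  · intro n hn
    simp [hn]

/-- At `t = 0` the even factor is `a^n`, so the series is a `q`-binomial series in base `q²`, equal
to `(abq;q²)_∞ / (a²;q²)_∞`. -/
theorem heineSeries_zero_one_ne_zero (hq : ‖q‖ < 1) (ha : ‖a‖ < 1) (hab : ‖a * b * q‖ < 1) :
    heineSeries a b q 0 1 ≠ 0 := by
  have e : heineSeries a b q 0 1 = ∑' n, qBinTerm (a ^ 2) (a * b * q) (q ^ 2) n := by
    refine tsum_congr fun n => ?_
    rw [oddFactor, evenFactor, ← Finset.prod_mul_distrib, qBinTerm, one_pow, mul_one]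
    refine Finset.prod_congr rfl fun k _ => ?_
    rw [← pow_mul, ← pow_mul, div_mul_div_comm]
    congr 1 <;> ring
  rw [e]
  refine tsum_qBinTerm_ne_zero ?_ ?_ hab
  · rw [norm_pow]; exact pow_lt_one₀ (norm_nonneg _) hq two_ne_zero
  · rw [norm_pow]; exact pow_lt_one₀ (norm_nonneg _) ha two_ne_zero

/-- The factors of `qBinTerm` with even index form `evenFactor` at `t = 1`, those with odd index
`oddFactor`. The factor `1 ^ n` matches the argument `s = 1` of `heineSeries`. -/
theorem qBinTerm_even (a b q : ℂ) (n : ℕ) :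
    qBinTerm a b q (2 * n) = oddFactor a b q n * evenFactor a b q 1 n * 1 ^ n := by
  induction n with
  | zero => simp [qBinTerm, oddFactor, evenFactor]
  | succ n ih =>
    rw [mul_add, mul_one, qBinTerm_succ, qBinTerm_succ, ih, oddFactor_succ, evenFactor_succ]
    ring

theorem qBinTerm_odd (a b q : ℂ) (n : ℕ) : qBinTerm a b q (2 * n + 1) =
    (a - b) / (1 - q) * (oddFactor a b q n * evenFactor a b q (q ^ 2) n * 1 ^ n) := by
  have h := evenFactor_succ' a b q 1 n
  rw [evenFactor_succ] at h
  rw [qBinTerm_succ, qBinTerm_even]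
  simp only [one_mul, mul_one] at h
  linear_combination oddFactor a b q n * h

theorem ramDen_eq_mul_heineSeries (b : ℂ) (hq : ‖q‖ < 1) (ha : ‖a‖ < 1) :
    ramDen a b q = 2 * (qPochInf a q * qPochInf (-a) q) * heineSeries a b q 1 1 ∧
    ramNum a b q = 2 * (qPochInf a q * qPochInf (-a) q) *
      ((a - b) / (1 - q) * heineSeries a b q (q ^ 2) 1) := by
  have hq2 : ‖q ^ 2‖ ≤ 1 := by rw [norm_pow]; exact pow_le_one₀ (norm_nonneg _) hq.le
  have hE : Summable fun n => qBinTerm a b q (2 * n) := by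
    simp_rw [qBinTerm_even]
    exact summable_heineSeries b hq ha (by simp) (by simp)
  have hO : Summable fun n => qBinTerm a b q (2 * n + 1) := by
    simp_rw [qBinTerm_odd]
    exact (summable_heineSeries b hq ha hq2 (by simp)).mul_left _
  have h1 := tsum_qBinTerm_mul_qPochInf b hq ha
  have h2 := tsum_qBinTerm_mul_qPochInf (-b) hq (x := -a) (by simpa using ha)
  have hnegE : ∀ n, qBinTerm (-a) (-b) q (2 * n) = qBinTerm a b q (2 * n) := fun n => by
    have := qBinTerm_mul (-1) a b q (2 * n)
    simpa using this
  have hnegO : ∀ n, qBinTerm (-a) (-b) q (2 * n + 1) = -qBinTerm a b q (2 * n + 1) := fun n => by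
    have := qBinTerm_mul (-1) a b q (2 * n + 1)
    simpa [pow_succ] using this
  rw [← tsum_even_add_odd hE hO] at h1
  rw [← tsum_even_add_odd (by simpa only [hnegE] using hE)
    (by simpa only [hnegO] using hO.neg)] at h2
  simp only [hnegE, hnegO, tsum_neg] at h2
  have e1 : ∑' n, qBinTerm a b q (2 * n) = heineSeries a b q 1 1 :=
    tsum_congr (qBinTerm_even a b q)
  have e2 : ∑' n, qBinTerm a b q (2 * n + 1) = (a - b) / (1 - q) * heineSeries a b q (q ^ 2) 1 := by
    rw [heineSeries, ← tsum_mul_left]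
    exact tsum_congr (qBinTerm_odd a b q)
  rw [e1, e2] at h1 h2
  constructor
  · simp only [ramDen, qPochInf₂]
    linear_combination -qPochInf (-a) q * h1 - qPochInf a q * h2
  · simp only [ramNum, qPochInf₂]
    linear_combination -qPochInf (-a) q * h1 + qPochInf a q * h2

/-! ### Contiguous relations by telescoping -/

theorem norm_mul_sq_le_one {t : ℂ} (hq : ‖q‖ < 1) (ht : ‖t‖ ≤ 1) : ‖t * q ^ 2‖ ≤ 1 := by
  rw [norm_mul, norm_pow]
  exact mul_le_one₀ ht (by positivity) (pow_le_one₀ (norm_nonneg _) hq.le)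

theorem tendsto_pow_two_mul_add (hq : ‖q‖ < 1) (c : ℕ) :
    Tendsto (fun N : ℕ => q ^ (2 * N + c)) atTop (𝓝 0) :=
  (tendsto_pow_atTop_nhds_zero_of_norm_lt_one hq).comp
    (tendsto_atTop_mono (fun N : ℕ => (by omega : N ≤ 2 * N + c)) tendsto_id)

theorem heineSeries_contiguous_one (b : ℂ) {t : ℂ} (hq : ‖q‖ < 1) (ha : ‖a‖ < 1) (ht : ‖t‖ ≤ 1) :
    q * heineSeries a b q t 1 = (a * b + q) * heineSeries a b q (t * q ^ 2) 1 -
      (a - b * (t * q ^ 2)) * (b - a * (t * q ^ 2)) / ((1 - t * q ^ 2 * q) * (1 - t * q)) *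
        heineSeries a b q (t * q ^ 2 * q ^ 2) 1 := by
  have ht2 := norm_mul_sq_le_one hq ht
  have s0 := summable_heineSeries b hq ha ht (s := 1) (by simp)
  have s1 := summable_heineSeries b hq ha ht2 (s := 1) (by simp)
  have s2 := summable_heineSeries b hq ha (norm_mul_sq_le_one hq ht2) (s := 1) (by simp)
  set c := (a - b * (t * q ^ 2)) * (b - a * (t * q ^ 2)) / ((1 - t * q ^ 2 * q) * (1 - t * q))
    with hc
  have n1 : 1 - t * q ≠ 0 := by simpa using one_sub_mul_pow_ne_zero hq ht 0
  have n2 : 1 - t * q ^ 2 * q ≠ 0 := by simpa using one_sub_mul_pow_ne_zero hq ht2 0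
  have s := ((s0.mul_left q).sub (s1.mul_left (a * b + q))).add (s2.mul_left c)
  have h := tsum_eq_zero_of_sum_tendsto_zero s
    (S := fun N => t * q * (b - a * q) / (1 - t * q) * ((a - b * q ^ (2 * N + 1)) /
      (1 - t * q ^ (2 * N + 3))) *
      (oddFactor a b q N * evenFactor a b q (t * q ^ 2) N * 1 ^ N)) ?_ ?_
  · rw [((s0.mul_left q).sub (s1.mul_left (a * b + q))).tsum_add (s2.mul_left c),
      (s0.mul_left q).tsum_sub (s1.mul_left (a * b + q)), tsum_mul_left, tsum_mul_left,
      tsum_mul_left] at h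
    simp only [heineSeries]
    linear_combination h
  · intro N
    induction N with
    | zero =>
      have n3 : 1 - t * q ^ 3 ≠ 0 := by simpa using one_sub_mul_pow_ne_zero hq ht 2
      simp [oddFactor, evenFactor, hc]
      field_simp
      ring
    | succ N ih =>
      have n3 := one_sub_mul_pow_ne_zero hq ht (2 * N + 2)
      have n4 := one_sub_mul_pow_ne_zero hq ht (2 * N + 4)
      have n5 := one_sub_pow_ne_zero hq (2 * N + 1)
      have e := evenFactor_succ' a b q (t * q ^ 2) (N + 1)
      -- The factor `(a - b t q²) / (1 - t q³)` of `c` is the one split off by `evenFactor_succ'`,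
      -- so all three terms become multiples of the same even factor at `t q²`.
      have e' : c * evenFactor a b q (t * q ^ 2 * q ^ 2) (N + 1) =
          (b - a * (t * q ^ 2)) / (1 - t * q) * evenFactor a b q (t * q ^ 2) (N + 1 + 1) := by
        rw [e, hc]; field_simp
      rw [Finset.sum_range_succ, ih]
      rw [show c * (oddFactor a b q (N + 1) * evenFactor a b q (t * q ^ 2 * q ^ 2) (N + 1) *
        1 ^ (N + 1)) = oddFactor a b q (N + 1) *
          (c * evenFactor a b q (t * q ^ 2 * q ^ 2) (N + 1)) by ring, e', evenFactor_succ' a b q t,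
        evenFactor_succ a b q _ (N + 1), evenFactor_succ a b q _ N, oddFactor_succ]
      generalize evenFactor a b q (t * q ^ 2) N = h
      generalize oddFactor a b q N = g
      have p1 : t * q ^ 2 * q ^ (2 * N + 1) = t * q ^ (2 * N + 2 + 1) := by ring
      have p2 : t * q ^ 2 * q ^ (2 * (N + 1) + 1) = t * q ^ (2 * N + 4 + 1) := by ring
      have p3 : t * q ^ (2 * (N + 1) + 3) = t * q ^ (2 * N + 4 + 1) := by ring
      have p4 : t * q ^ (2 * N + 3) = t * q ^ (2 * N + 2 + 1) := by ring
      rw [p1, p2, p3, p4]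
      simp only [one_pow, mul_one]
      field_simp
      ring
  · have l1 := ((tendsto_pow_two_mul_add hq 1).const_mul b).const_sub a
    have l2 := ((tendsto_pow_two_mul_add hq 3).const_mul t).const_sub 1
    have := ((l1.div l2 (by simp)).const_mul (t * q * (b - a * q) / (1 - t * q))).mul
      s1.tendsto_atTop_zero
    simpa using this

theorem heineSeries_contiguous_diagonal (b : ℂ) {t : ℂ} (hq : ‖q‖ < 1) (ha : ‖a‖ < 1)
    (ht : ‖t‖ ≤ 1) :
    (1 - t * q) * heineSeries a b q t t = (1 - a * b * t ^ 2) * heineSeries a b q (t * q ^ 2) t -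
      (1 - b ^ 2 * t) * q * t * heineSeries a b q (t * q ^ 2) (t * q ^ 2) := by
  have ht2 := norm_mul_sq_le_one hq ht
  have s0 := summable_heineSeries b hq ha ht (s := t) ht
  have s1 := summable_heineSeries b hq ha ht2 (s := t) ht
  have s2 := summable_heineSeries b hq ha ht2 (s := t * q ^ 2) ht2
  have n1 : 1 - t * q ≠ 0 := by simpa using one_sub_mul_pow_ne_zero hq ht 0
  have s := ((s0.mul_left (1 - t * q)).sub (s1.mul_left (1 - a * b * t ^ 2))).add
    (s2.mul_left ((1 - b ^ 2 * t) * q * t))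
  have h := tsum_eq_zero_of_sum_tendsto_zero s
    (S := fun N => b * t ^ 2 * (a - b * q ^ (2 * N + 1)) *
      (oddFactor a b q N * evenFactor a b q (t * q ^ 2) N * t ^ N)) ?_ ?_
  · rw [((s0.mul_left _).sub (s1.mul_left _)).tsum_add (s2.mul_left _),
      (s0.mul_left _).tsum_sub (s1.mul_left _), tsum_mul_left, tsum_mul_left,
      tsum_mul_left] at h
    simp only [heineSeries]
    linear_combination h
  · intro N
    induction N with
    | zero =>
      simp [oddFactor, evenFactor]
      ring
    | succ N ih =>
      have n3 := one_sub_mul_pow_ne_zero hq ht (2 * N + 2)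
      have n5 := one_sub_pow_ne_zero hq (2 * N + 1)
      rw [Finset.sum_range_succ, ih]
      rw [evenFactor_succ' a b q t, evenFactor_succ a b q _ N, oddFactor_succ]
      generalize evenFactor a b q (t * q ^ 2) N = h
      generalize oddFactor a b q N = g
      have p1 : t * q ^ 2 * q ^ (2 * N + 1) = t * q ^ (2 * N + 2 + 1) := by ring
      rw [p1]
      field_simp
      ring
  · have l1 := ((tendsto_pow_two_mul_add hq 1).const_mul b).const_sub a
    have := (l1.const_mul (b * t ^ 2)).mul s1.tendsto_atTop_zero
    simpa using this

theorem heineSeries_contiguous_offDiagonal (b : ℂ) {t : ℂ} (hq : ‖q‖ < 1) (ha : ‖a‖ < 1)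
    (ht : ‖t‖ ≤ 1) :
    (1 - a ^ 2 * t) * heineSeries a b q (t * q ^ 2) t =
      (1 - a * b * q ^ 2 * t ^ 2) * heineSeries a b q (t * q ^ 2) (t * q ^ 2) -
      (a - b * (t * q ^ 2)) * (b - a * (t * q ^ 2)) * q * t / (1 - t * q ^ 2 * q) *
        heineSeries a b q (t * q ^ 2 * q ^ 2) (t * q ^ 2) := by
  have ht2 := norm_mul_sq_le_one hq ht
  have s0 := summable_heineSeries b hq ha ht2 (s := t) ht
  have s1 := summable_heineSeries b hq ha ht2 (s := t * q ^ 2) ht2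
  have s2 := summable_heineSeries b hq ha (norm_mul_sq_le_one hq ht2) (s := t * q ^ 2) ht2
  set c := (a - b * (t * q ^ 2)) * (b - a * (t * q ^ 2)) * q * t / (1 - t * q ^ 2 * q) with hc
  have n2 : 1 - t * q ^ 2 * q ≠ 0 := by simpa using one_sub_mul_pow_ne_zero hq ht2 0
  have s := ((s0.mul_left (1 - a ^ 2 * t)).sub (s1.mul_left (1 - a * b * q ^ 2 * t ^ 2))).add
    (s2.mul_left c)
  have hterm : ∀ n, c * (oddFactor a b q n * evenFactor a b q (t * q ^ 2 * q ^ 2) n *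
      (t * q ^ 2) ^ n) = (b - a * (t * q ^ 2)) * q * t * (oddFactor a b q n *
        evenFactor a b q (t * q ^ 2) (n + 1) * (t * q ^ 2) ^ n) := by
    intro n
    rw [evenFactor_succ' a b q (t * q ^ 2) n, hc]
    ring
  have h := tsum_eq_zero_of_sum_tendsto_zero s
    -- The closed form is the first omitted term of the series at `(t q², t)`, times `-(1 -
    -- q^{2(N+1)})`.
    (S := fun N => -((1 - q ^ (2 * (N + 1))) * (oddFactor a b q (N + 1) *
      evenFactor a b q (t * q ^ 2) (N + 1) * t ^ (N + 1)))) ?_ ?_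
  · rw [((s0.mul_left _).sub (s1.mul_left _)).tsum_add (s2.mul_left _),
      (s0.mul_left _).tsum_sub (s1.mul_left _), tsum_mul_left, tsum_mul_left,
      tsum_mul_left] at h
    simp only [heineSeries]
    linear_combination h
  · intro N
    induction N with
    | zero =>
      have n3 : 1 - t * q ^ 3 ≠ 0 := by simpa using one_sub_mul_pow_ne_zero hq ht 2
      have n5 : 1 - q ^ 2 ≠ 0 := one_sub_pow_ne_zero hq 1
      have p1 : t * q ^ 2 * q = t * q ^ 3 := by ring
      simp only [zero_add, Finset.sum_range_one, hterm]
      have n3' := mul_inv_cancel₀ n3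
      simp [oddFactor, evenFactor, p1]
      field_simp
      linear_combination (t * a ^ 2 - t ^ 2 * a * b * q ^ 2) * n3'
    | succ N ih =>
      have n3 := one_sub_mul_pow_ne_zero hq ht (2 * N + 4)
      have n5 := one_sub_pow_ne_zero hq (2 * N + 3)
      rw [Finset.sum_range_succ, ih, hterm]
      rw [evenFactor_succ a b q _ (N + 1), oddFactor_succ a b q (N + 1)]
      generalize evenFactor a b q (t * q ^ 2) (N + 1) = h
      generalize oddFactor a b q (N + 1) = g
      have p1 : t * q ^ 2 * q ^ (2 * (N + 1) + 1) = t * q ^ (2 * N + 4 + 1) := by ring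
      have p2 : q ^ (2 * (N + 1) + 1 + 1) = q ^ (2 * N + 3 + 1) := by ring
      have p3 : q ^ (2 * (N + 1 + 1)) = q ^ (2 * N + 3 + 1) := by ring
      rw [p1, p2, p3]
      field_simp
      ring
  · have l1 := (tendsto_pow_two_mul_add hq 2).const_sub 1
    have := (l1.mul ((tendsto_add_atTop_iff_nat 1).2 s0.tendsto_atTop_zero)).neg
    simpa [mul_add] using this

/-! ### The two continued fractions -/

theorem norm_pow_le_one (hq : ‖q‖ < 1) (n : ℕ) : ‖q ^ n‖ ≤ 1 := by
  rw [norm_pow]; exact pow_le_one₀ (norm_nonneg _) hq.le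

/-- The minimal solution of the recurrence of the first continued fraction. -/
noncomputable def firstMinimal (a b q : ℂ) (n : ℕ) : ℂ :=
  heineSeries a b q (q ^ (2 * n)) 1 / (q ^ n * ∏ k ∈ Finset.range n, (1 - q ^ (2 * k + 1)))

theorem prod_one_sub_pow_ne_zero (hq : ‖q‖ < 1) (n : ℕ) :
    ∏ k ∈ Finset.range n, (1 - q ^ (2 * k + 1)) ≠ 0 :=
  Finset.prod_ne_zero_iff.2 fun k _ => one_sub_pow_ne_zero hq (2 * k)

/-- This is `heineSeries_contiguous_one` at `t = q^{2n}`. The normalising factor `q^n ∏ (1 -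
q^{2k+1})` clears the leading `q` and the denominators, which is how `1 - q^{2n+1}` enters the
partial denominators. -/
theorem firstMinimal_recurrence (b : ℂ) (hq : ‖q‖ < 1) (ha : ‖a‖ < 1) (hq0 : q ≠ 0) (n : ℕ) :
    firstMinimal a b q n = firstDen a b q n * firstMinimal a b q (n + 1) +
      firstNum a b q (n + 1) * firstMinimal a b q (n + 2) := by
  have h := heineSeries_contiguous_one b hq ha (norm_pow_le_one hq (2 * n))
  have n1 := one_sub_pow_ne_zero hq (2 * n)
  have n2 := one_sub_pow_ne_zero hq (2 * n + 2)
  have n3 := prod_one_sub_pow_ne_zero hq n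
  have e1 : q ^ (2 * n) * q ^ 2 = q ^ (2 * (n + 1)) := by ring
  have e2 : q ^ (2 * (n + 1)) * q ^ 2 = q ^ (2 * (n + 2)) := by ring
  have e3 : q ^ (2 * (n + 1)) * q = q ^ (2 * n + 2 + 1) := by ring
  rw [e1, e2, e3, ← pow_succ] at h
  have h' : heineSeries a b q (q ^ (2 * n)) 1 =
      ((a * b + q) * heineSeries a b q (q ^ (2 * (n + 1))) 1 -
      (a - b * q ^ (2 * (n + 1))) * (b - a * q ^ (2 * (n + 1))) /
        ((1 - q ^ (2 * n + 2 + 1)) * (1 - q ^ (2 * n + 1))) *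
      heineSeries a b q (q ^ (2 * (n + 2))) 1) / q := by
    rw [← h]; field_simp
  rw [firstMinimal, firstMinimal, firstMinimal, h', Finset.prod_range_succ _ (n + 1),
    Finset.prod_range_succ _ n, firstDen, firstNum]
  have e4 : 2 * (n + 1) + 1 = 2 * n + 2 + 1 := by ring
  rw [e4]
  generalize ∏ k ∈ Finset.range n, (1 - q ^ (2 * k + 1)) = d at *
  generalize heineSeries a b q (q ^ (2 * (n + 1))) 1 = x
  generalize heineSeries a b q (q ^ (2 * (n + 2))) 1 = y
  generalize q ^ (2 * (n + 1)) = u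
  generalize 1 - q ^ (2 * n + 2 + 1) = v at *
  generalize 1 - q ^ (2 * n + 1) = w at *
  field_simp
  ring

theorem tendsto_heineSeries_pow (b : ℂ) (hq : ‖q‖ < 1) (ha : ‖a‖ < 1) :
    Tendsto (fun n : ℕ => heineSeries a b q (q ^ (2 * n)) 1) atTop (𝓝 (heineSeries a b q 0 1)) :=
  tendsto_heineSeries b hq ha (by simp) (fun _ => norm_pow_le_one hq _) (fun _ => by simp)
    (tendsto_pow_two_mul_add hq 0) tendsto_const_nhds

theorem cfConvergesTo_first (hq : ‖q‖ < 1) (ha : ‖a‖ < 1) (hq0 : q ≠ 0) (hab : ‖a * b / q‖ < 1) :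
    CFConvergesTo (firstNum a b q) (firstDen a b q)
      (sphereDiv (ramNum a b q) (ramDen a b q)) := by
  obtain ⟨hD, hN⟩ := ramDen_eq_mul_heineSeries b hq ha
  have h0 := ramNum_ne_zero_or_ramDen_ne_zero b hq ha
  have e1 : firstNum a b q 0 * firstMinimal a b q 1 =
      (a - b) / (1 - q) * heineSeries a b q (q ^ 2) 1 := by
    have := one_sub_ne_zero_of_norm_lt_one hq
    simp [firstNum, firstMinimal]
    field_simp
  have e0 : firstMinimal a b q 0 = heineSeries a b q 1 1 := by simp [firstMinimal]
  rw [← e1] at hN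
  rw [← e0] at hD
  -- A vanishing common factor would make `ramNum` and `ramDen` both zero.
  have hc : 2 * (qPochInf a q * qPochInf (-a) q) ≠ 0 := by
    intro h
    simp [hD, hN, h] at h0
  rw [hD, hN, sphereDiv_mul_left hc]
  have hlim := tendsto_heineSeries_pow b hq ha
  have hE0 : heineSeries a b q 0 1 ≠ 0 := by
    refine heineSeries_zero_one_ne_zero hq ha ?_
    have e : a * b * q = a * b / q * (q * q) := by field_simp
    rw [e, norm_mul, norm_mul]
    exact mul_lt_one_of_nonneg_of_lt_one_left (norm_nonneg _) hab
      (mul_le_one₀ hq.le (norm_nonneg _) hq.le)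
  have hev := hlim.eventually_ne hE0
  refine cfConvergesTo_of_recurrence _ _ _ (ρ := -(a * b / q)) (by simpa using hab)
    (firstMinimal_recurrence b hq ha hq0) ?_ ?_ ?_
  · filter_upwards [hev] with n hn
    exact div_ne_zero hn (mul_ne_zero (pow_ne_zero _ hq0) (prod_one_sub_pow_ne_zero hq n))
  · have l0 := tendsto_pow_two_mul_add hq 2
    have l1 := ((((l0.const_mul b).const_sub a).mul ((l0.const_mul a).const_sub b)).mul_const
      q⁻¹).neg
    have l2 := ((tendsto_pow_two_mul_add hq 1).const_sub 1).mul
      ((tendsto_pow_two_mul_add hq 3).const_sub 1)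
    have l3 := ((tendsto_add_atTop_iff_nat 2).2 hlim).div hlim hE0
    have l4 := (l1.mul l3).div l2 (by simp)
    have e : -((a - b * 0) * (b - a * 0) * q⁻¹) * (heineSeries a b q 0 1 / heineSeries a b q 0 1) /
        ((1 - 0) * (1 - 0)) = -(a * b / q) := by
      rw [div_self hE0]; ring
    rw [e] at l4
    refine l4.congr' ?_
    filter_upwards [hev] with n hn
    have n1 := one_sub_pow_ne_zero hq (2 * n)
    have n2 := one_sub_pow_ne_zero hq (2 * n + 2)
    have n3 := prod_one_sub_pow_ne_zero hq n
    simp only [Pi.div_apply, firstMinimal, firstNum, Finset.prod_range_succ]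
    have e4 : 2 * (n + 1) + 1 = 2 * n + 2 + 1 := by ring
    have e5 : 2 * (n + 1) = 2 * n + 2 := by ring
    rw [e4, e5]
    generalize ∏ k ∈ Finset.range n, (1 - q ^ (2 * k + 1)) = d at *
    generalize heineSeries a b q (q ^ (2 * n)) 1 = x at *
    generalize heineSeries a b q (q ^ (2 * (n + 2))) 1 = y
    generalize q ^ (2 * n + 2) = u
    generalize 1 - q ^ (2 * n + 2 + 1) = v at *
    generalize 1 - q ^ (2 * n + 1) = w at *
    field_simp
    ring
  · by_contra! h
    simp [hD, hN, h.1, h.2] at h0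

/-- The minimal solution of the recurrence of the second continued fraction. -/
noncomputable def secondMinimal (a b q : ℂ) (n : ℕ) : ℂ :=
  heineSeries a b q (q ^ (2 * ((n + 1) / 2))) (q ^ (2 * (n / 2))) /
    ((∏ k ∈ Finset.range ((n + 1) / 2), (1 - q ^ (2 * k + 1))) *
      ∏ k ∈ Finset.range (n / 2), (1 - a ^ 2 * q ^ (2 * k)))

theorem one_sub_sq_mul_pow_ne_zero (hq : ‖q‖ < 1) (ha : ‖a‖ < 1) (n : ℕ) :
    1 - a ^ 2 * q ^ n ≠ 0 := by
  apply one_sub_ne_zero_of_norm_lt_one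
  rw [norm_mul]
  refine (mul_le_of_le_one_right (norm_nonneg _) (norm_pow_le_one hq n)).trans_lt ?_
  rw [norm_pow]
  exact pow_lt_one₀ (norm_nonneg _) ha two_ne_zero

theorem prod_one_sub_sq_mul_pow_ne_zero (hq : ‖q‖ < 1) (ha : ‖a‖ < 1) (n : ℕ) :
    ∏ k ∈ Finset.range n, (1 - a ^ 2 * q ^ (2 * k)) ≠ 0 :=
  Finset.prod_ne_zero_iff.2 fun k _ => one_sub_sq_mul_pow_ne_zero hq ha (2 * k)

theorem secondMinimal_add_two (a b q : ℂ) (n : ℕ) : secondMinimal a b q (n + 2) =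
    heineSeries a b q (q ^ (2 * ((n + 1) / 2 + 1))) (q ^ (2 * (n / 2 + 1))) /
    ((∏ k ∈ Finset.range ((n + 1) / 2), (1 - q ^ (2 * k + 1))) *
      (1 - q ^ (2 * ((n + 1) / 2) + 1)) *
      ((∏ k ∈ Finset.range (n / 2), (1 - a ^ 2 * q ^ (2 * k))) *
        (1 - a ^ 2 * q ^ (2 * (n / 2))))) := by
  have e1 : (n + 2 + 1) / 2 = (n + 1) / 2 + 1 := by omega
  have e2 : (n + 2) / 2 = n / 2 + 1 := by omega
  rw [secondMinimal, e1, e2, Finset.prod_range_succ, Finset.prod_range_succ]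

theorem secondMinimal_even (a b q : ℂ) (m : ℕ) : secondMinimal a b q (2 * m) =
    heineSeries a b q (q ^ (2 * m)) (q ^ (2 * m)) /
    ((∏ k ∈ Finset.range m, (1 - q ^ (2 * k + 1))) *
      ∏ k ∈ Finset.range m, (1 - a ^ 2 * q ^ (2 * k))) := by
  have e1 : (2 * m + 1) / 2 = m := by omega
  have e2 : 2 * m / 2 = m := by omega
  rw [secondMinimal, e1, e2]

theorem secondMinimal_odd (a b q : ℂ) (m : ℕ) : secondMinimal a b q (2 * m + 1) =
    heineSeries a b q (q ^ (2 * (m + 1))) (q ^ (2 * m)) /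
    ((∏ k ∈ Finset.range (m + 1), (1 - q ^ (2 * k + 1))) *
      ∏ k ∈ Finset.range m, (1 - a ^ 2 * q ^ (2 * k))) := by
  have e1 : (2 * m + 1 + 1) / 2 = m + 1 := by omega
  have e2 : (2 * m + 1) / 2 = m := by omega
  rw [secondMinimal, e1, e2]

/-- At `t = q^{2m}`, even `n` is the diagonal relation and odd `n` the off-diagonal one. The factor
`1 - a² q^{2m}` of the partial numerators comes from the normalisation, the factor `1 - b² q^{2m}`
from the diagonal relation. -/
theorem secondMinimal_recurrence (b : ℂ) (hq : ‖q‖ < 1) (ha : ‖a‖ < 1) (n : ℕ) :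
    secondMinimal a b q n = secondDen a b q n * secondMinimal a b q (n + 1) +
      secondNum a b q (n + 1) * secondMinimal a b q (n + 2) := by
  obtain ⟨m, rfl | rfl⟩ : ∃ m, n = 2 * m ∨ n = 2 * m + 1 := ⟨n / 2, by omega⟩
  all_goals
    have ht := norm_pow_le_one hq (2 * m)
    have n1 := one_sub_pow_ne_zero hq (2 * m)
    have n2 := one_sub_pow_ne_zero hq (2 * m + 2)
    have n3 := prod_one_sub_pow_ne_zero hq m
    have n4 := prod_one_sub_sq_mul_pow_ne_zero hq ha m
    have n5 := one_sub_sq_mul_pow_ne_zero hq ha (2 * m)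
    have e1 : q ^ (2 * m) * q ^ 2 = q ^ (2 * (m + 1)) := by ring
    have e2 : q ^ (2 * (m + 1)) * q ^ 2 = q ^ (2 * (m + 2)) := by ring
  · have h := heineSeries_contiguous_diagonal b hq ha ht
    have hα : secondNum a b q (2 * m + 1) = -secondNumOdd a b q m := by
      have : 2 * m / 2 = m := by omega
      simp [secondNum, this]
    rw [show 2 * m + 2 = 2 * (m + 1) by ring, secondMinimal_even, secondMinimal_odd,
      secondMinimal_even, hα, secondDen, secondNumOdd, Finset.prod_range_succ,
      Finset.prod_range_succ]
    rw [e1, ← pow_succ] at h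
    have p1 : q ^ (2 * (2 * m)) = (q ^ (2 * m)) ^ 2 := by ring
    have p2 : q ^ (2 * m + 1) = q * q ^ (2 * m) := by ring
    rw [p1]
    have h' := eq_div_of_mul_eq n1 ((mul_comm _ _).trans h)
    rw [h']
    rw [p2] at n1 ⊢
    generalize ∏ k ∈ Finset.range m, (1 - q ^ (2 * k + 1)) = d at *
    generalize ∏ k ∈ Finset.range m, (1 - a ^ 2 * q ^ (2 * k)) = d' at *
    generalize heineSeries a b q (q ^ (2 * (m + 1))) (q ^ (2 * m)) = x
    generalize heineSeries a b q (q ^ (2 * (m + 1))) (q ^ (2 * (m + 1))) = y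
    clear h h'
    generalize q ^ (2 * m) = u at *
    generalize hw : 1 - q * u = w at *
    generalize hv : 1 - a ^ 2 * u = v at *
    field_simp
    ring
  · have h := heineSeries_contiguous_offDiagonal b hq ha ht
    have hα : secondNum a b q (2 * m + 1 + 1) = -secondNumEven a b q m := by
      have : (2 * m + 1) / 2 = m := by omega
      have h2 : (2 * m + 1) % 2 = 1 := by omega
      simp [secondNum, this, h2]
    rw [show 2 * m + 1 + 1 = 2 * (m + 1) by ring] at *
    rw [show 2 * m + 1 + 2 = 2 * (m + 1) + 1 by ring, secondMinimal_odd, secondMinimal_even,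
      secondMinimal_odd, hα, secondDen, secondNumEven, Finset.prod_range_succ _ (m + 1),
      Finset.prod_range_succ (fun k => 1 - a ^ 2 * q ^ (2 * k)) m]
    have p0 : q ^ (2 * (m + 1)) * q = q ^ (2 * m + 2 + 1) := by ring
    rw [e1, e2, p0] at h
    have p1 : q ^ (2 * (2 * m + 1)) = q ^ 2 * (q ^ (2 * m)) ^ 2 := by ring
    have p2 : q ^ (2 * m + 1) = q * q ^ (2 * m) := by ring
    have p3 : 2 * m + 2 = 2 * (m + 1) := by ring
    have p4 : 2 * (m + 1) + 1 = 2 * m + 2 + 1 := by ring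
    have h' := eq_div_of_mul_eq n5 ((mul_comm _ _).trans h)
    have n6 := prod_one_sub_pow_ne_zero hq (m + 1)
    rw [h', p1, p4, p2]
    generalize 1 - q ^ (2 * m + 2 + 1) = w at *
    rw [p3]
    generalize ∏ k ∈ Finset.range (m + 1), (1 - q ^ (2 * k + 1)) = d at *
    generalize ∏ k ∈ Finset.range m, (1 - a ^ 2 * q ^ (2 * k)) = d' at *
    generalize heineSeries a b q (q ^ (2 * (m + 1))) (q ^ (2 * (m + 1))) = x
    generalize heineSeries a b q (q ^ (2 * (m + 2))) (q ^ (2 * (m + 1))) = y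
    generalize q ^ (2 * (m + 1)) = r at *
    generalize q ^ (2 * m) = u at *
    generalize hv : 1 - a ^ 2 * u = v at *
    field_simp
    ring

theorem tendsto_secondNum (a b : ℂ) (hq : ‖q‖ < 1) :
    Tendsto (fun n => secondNum a b q (n + 1)) atTop (𝓝 0) := by
  have hdiv : Tendsto (fun n : ℕ => n / 2) atTop atTop := Nat.tendsto_div_const_atTop two_ne_zero
  have l0 := tendsto_pow_two_mul_add hq 0
  have l1 := tendsto_pow_two_mul_add hq 1
  have l2 := tendsto_pow_two_mul_add hq 2
  have h1 : Tendsto (fun m => -secondNumOdd a b q m) atTop (𝓝 0) := by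
    have := ((((l0.const_mul (a ^ 2)).const_sub 1).mul
      ((l0.const_mul (b ^ 2)).const_sub 1)).mul l1).neg
    simpa [secondNumOdd] using this
  have h2 : Tendsto (fun m => -secondNumEven a b q m) atTop (𝓝 0) := by
    have := ((((l2.const_mul b).const_sub a).mul ((l2.const_mul a).const_sub b)).mul l1).neg
    simpa [secondNumEven] using this
  exact (h1.comp hdiv).if' (h2.comp hdiv)

theorem cfConvergesTo_second (b : ℂ) (hq : ‖q‖ < 1) (ha : ‖a‖ < 1) :
    CFConvergesTo (secondNum a b q) (secondDen a b q)
      (sphereDiv (ramNum a b q) (ramDen a b q)) := by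
  obtain ⟨hD, hN⟩ := ramDen_eq_mul_heineSeries b hq ha
  have h0 := ramNum_ne_zero_or_ramDen_ne_zero b hq ha
  have e1 : secondNum a b q 0 * secondMinimal a b q 1 =
      (a - b) / (1 - q) * heineSeries a b q (q ^ 2) 1 := by
    simp [secondNum, secondMinimal]
    ring
  have e0 : secondMinimal a b q 0 = heineSeries a b q 1 1 := by simp [secondMinimal]
  rw [← e1] at hN
  rw [← e0] at hD
  have hc : 2 * (qPochInf a q * qPochInf (-a) q) ≠ 0 := by
    intro h
    simp [hD, hN, h] at h0
  rw [hD, hN, sphereDiv_mul_left hc]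
  have hdiv : Tendsto (fun n : ℕ => n / 2) atTop atTop := Nat.tendsto_div_const_atTop two_ne_zero
  have hdiv' : Tendsto (fun n : ℕ => (n + 1) / 2) atTop atTop :=
    hdiv.comp (tendsto_add_atTop_nat 1)
  have hp := tendsto_pow_two_mul_add hq 0
  have hlim : Tendsto (fun n : ℕ => heineSeries a b q (q ^ (2 * ((n + 1) / 2))) (q ^ (2 * (n / 2))))
      atTop (𝓝 1) := by
    -- Both parameters of the staircase tend to `0`, and `1` is the value of the series at `(0, 0)`.
    rw [← heineSeries_zero_right a b q 0]
    exact tendsto_heineSeries b hq ha (by simp) (fun _ => norm_pow_le_one hq _)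
      (fun _ => norm_pow_le_one hq _) (hp.comp hdiv') (hp.comp hdiv)
  have hev := hlim.eventually_ne one_ne_zero
  refine cfConvergesTo_of_recurrence _ _ _ (ρ := 0) (by simp)
    (secondMinimal_recurrence b hq ha) ?_ ?_ ?_
  · filter_upwards [hev] with n hn
    exact div_ne_zero hn (mul_ne_zero (prod_one_sub_pow_ne_zero hq _)
      (prod_one_sub_sq_mul_pow_ne_zero hq ha _))
  · have l2 := (((tendsto_pow_two_mul_add hq 1).comp hdiv').const_sub 1).mul
      (((hp.comp hdiv).const_mul (a ^ 2)).const_sub 1)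
    have l3 := ((tendsto_add_atTop_iff_nat 2).2 hlim).div hlim one_ne_zero
    have l4 := ((tendsto_secondNum a b hq).mul l3).div l2 (by simp)
    rw [zero_mul, zero_div] at l4
    refine l4.congr' ?_
    filter_upwards [hev] with n hn
    have n1 := one_sub_pow_ne_zero hq (2 * ((n + 1) / 2))
    have n2 := one_sub_sq_mul_pow_ne_zero hq ha (2 * (n / 2))
    have n3 := prod_one_sub_pow_ne_zero hq ((n + 1) / 2)
    have n4 := prod_one_sub_sq_mul_pow_ne_zero hq ha (n / 2)
    have e4 : (n + 2 + 1) / 2 = (n + 1) / 2 + 1 := by omega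
    have e5 : (n + 2) / 2 = n / 2 + 1 := by omega
    simp only [Pi.div_apply, Function.comp_apply, secondMinimal_add_two, e4, e5, add_zero]
    rw [secondMinimal]
    generalize ∏ k ∈ Finset.range ((n + 1) / 2), (1 - q ^ (2 * k + 1)) = d at *
    generalize ∏ k ∈ Finset.range (n / 2), (1 - a ^ 2 * q ^ (2 * k)) = d' at *
    generalize 1 - q ^ (2 * ((n + 1) / 2) + 1) = v at *
    generalize 1 - a ^ 2 * q ^ (2 * (n / 2)) = w at *
    field_simp
  · by_contra! h
    simp [hD, hN, h.1, h.2] at h0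

end

theorem mainTheorem4 (a b q : ℂ) (hq : ‖q‖ < 1) (ha : ‖a ^ 2‖ < 1) :
    (ramNum a b q ≠ 0 ∨ ramDen a b q ≠ 0) ∧
    (q ≠ 0 → ‖a * b / q‖ < 1 →
      CFConvergesTo (firstNum a b q) (firstDen a b q)
        (sphereDiv (ramNum a b q) (ramDen a b q))) ∧
    (b ≠ 0 → ‖a * q / b‖ < 1 →
      CFConvergesTo (secondNum a b q) (secondDen a b q)
        (sphereDiv (ramNum a b q) (ramDen a b q))) := by
  have ha1 : ‖a‖ < 1 := by
    rw [norm_pow] at ha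
    exact (pow_lt_one_iff_of_nonneg (norm_nonneg a) two_ne_zero).1 ha
  exact ⟨ramNum_ne_zero_or_ramDen_ne_zero b hq ha1,
    fun hq0 hab => cfConvergesTo_first hq ha1 hq0 hab, fun _ _ => cfConvergesTo_second b hq ha1⟩
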